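/- **Conventions.** Let $G$ be a finite simple graph with at least one vertex. Write $d_v$ for the degree of $v$ and $\delta(\cdot)$ for the minimum degree (with $\delta=0$ for the graph without vertices). $\alpha(G)$ is the independence number. $G^k$ is the graph on $V(G)^k$ in which distinct words $u,v$ are adjacent if and only if for every $i$ either $u_i=v_i$ or $\{u_i,v_i\}\in E(G)$, and $\Theta(G)=\sup_{k\ge1}\alpha(G^k)^{1/k}=\lim_{k\to\infty}\alpha(G^k)^{1/k}$ is the Shannon capacity. An orthonormal representation of $G$ is a family $(u_i)_{i\in V(G)}$ of unit vectors in some $\mathbb R^d$ with $u_i^\top u_j=0$ for distinct nonadjacent $i,j$; its value is $\min_c\max_i (c^\top u_i)^{-2}$ over unit vectors $c\in\mathbb R^d$ (with $1/0=\infty$), and the Lovász theta function $\vartheta(G)$ is the minimum value of all orthonormal representations of $G$. The adjacency eigenvalues of $G$ are those of its adjacency matrix $A$, the Laplacian eigenvalues are those of $D-A$ with $D$ the diagonal matrix of degrees, and, if $\delta(G)>0$, the normalized Laplacian eigenvalues are those of the matrix with diagonal entries $1$, entries $-(d_id_j)^{-1/2}$ for $\{i,j\}\in E(G)$, and $0$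 otherwise. **Theorem 7.1.** Let $C$ be an independent set of $G$. Then $$\alpha(G)=\Theta(G)=\vartheta(G)=|C|$$ if one of the following conditions holds. 1. There is $\lambda>-\tau$ such that every vertex not in $C$ is adjacent to exactly $\lambda$ vertices of $C$, where $\tau$ is the minimum adjacency eigenvalue of $G$. 2. $G$ is regular, its minimum adjacency eigenvalue $\tau$ is negative, and every vertex not in $C$ is adjacent to exactly $-\tau$ vertices of $C$. 3. The largest Laplacian eigenvalue $\mu$ of $G$ is positive, $d_u=\delta(G)$ for each $u\in C$, and every vertex not in $C$ is adjacent to exactly $\mu-\delta(G)$ vertices of $C$. 4. $\delta(G)>0$, $d_u=\delta(G)$ for each $u\in C$, and every vertex $v$ not in $C$ is adjacent to exactly $(\mu-1)d_v$ vertices of $C$, where $\mu$ is the largest normalized Laplacian eigenvalue of $G$. 5. Every vertex not in $C$ is adjacent to all vertices of $C$, and $2|C|\ge|V(G)|-\delta(G-C)$, where $G-C$ is the subgraph of $G$ induced by the vertices not in $C$. 6. $G$ has a spanning subgraph $H$ with $\delta(H)>0$ that is semiregular bipartite with parameters $(n_1,n_2,r_1,r_2)$, $n_1\le n_2$ (that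 is, $V(G)$ is the disjoint union of $V_1,V_2$, each edge of $H$ joins $V_1$ to $V_2$, and for $i=1,2$ we have $|V_i|=n_i$ and every vertex in $V_i$ has degree $r_i$ in $H$), and $C=V_2$ is the colour class with $n_2$ vertices. 7. There is a clique covering $\varepsilon$ of $G$ (a set of cliques such that every edge of $G$ lies in at least one of them) such that, with $d_u^\varepsilon$ the number of cliques in $\varepsilon$ containing $u$, we have $\min_{u\in V(G)}d_u^\varepsilon>0$, $d_v^\varepsilon=\min_{u\in V(G)}d_u^\varepsilon$ for each $v\in C$, and $|C\cap Q|=1$ for each $Q\in\varepsilon$. 8. There is a $k$-uniform hypergraph $H$, $k\ge1$ (each edge has exactly $k$ vertices), such that $G$ is (isomorphic to) the intersection graph of $H$, whose vertices are the edges of $H$, two distinct ones being adjacent if and only if they intersect, and $C$ corresponds to a perfect matching of $H$, that is, a set of pairwise disjoint edges that covers all vertices of $H$. -/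

import Mathlib

open scoped ENNReal Topology
open Filter

namespace SimpleGraph

/-- The power `G^k`: two distinct words of length `k` are adjacent iff in each coordinate their
letters are equal or adjacent in `G`. -/
def strongPow {V : Type*} (G : SimpleGraph V) (k : ℕ) : SimpleGraph (Fin k → V) where
  Adj u v := u ≠ v ∧ ∀ i, u i = v i ∨ G.Adj (u i) (v i)
  symm := ⟨fun _ _ h => ⟨h.1.symm, fun i => (h.2 i).imp Eq.symm fun a => a.symm⟩⟩
  loopless := ⟨fun _ h => h.1 rfl⟩

/-- The Shannon capacity `Θ(G) = sup_{k ≥ 1} α(G^k)^(1/k)`. The supremum is over a bounded set and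
is equal to `lim_k α(G^k)^(1/k)`: see `bddAbove_shannonCapacity` and `tendsto_shannonCapacity`. -/
noncomputable def shannonCapacity {V : Type*} (G : SimpleGraph V) : ℝ :=
  ⨆ k : ℕ+, ((G.strongPow k).indepNum : ℝ) ^ (1 / ((k : ℕ) : ℝ))

theorem indepNum_strongPow_le {V : Type*} [Fintype V] (G : SimpleGraph V) (k : ℕ) :
    (G.strongPow k).indepNum ≤ Fintype.card V ^ k := by
  classical
  obtain ⟨s, hs⟩ := (G.strongPow k).exists_isNIndepSet_indepNum
  rw [← hs.card_eq]
  exact (Finset.card_le_univ s).trans (by simp)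

theorem indepNum_strongPow_pos {V : Type*} [Fintype V] [Nonempty V] (G : SimpleGraph V) (k : ℕ) :
    0 < (G.strongPow k).indepNum := by
  classical
  have h : (G.strongPow k).IsIndepSet
      (({fun _ => Classical.arbitrary V} : Finset (Fin k → V)) : Set (Fin k → V)) := by
    simp [isIndepSet_iff]
  exact Nat.lt_of_lt_of_le (by simp) h.card_le_indepNum

theorem indepNum_strongPow_mul_le {V : Type*} [Fintype V] (G : SimpleGraph V) (m n : ℕ) :
    (G.strongPow m).indepNum * (G.strongPow n).indepNum ≤ (G.strongPow (m + n)).indepNum := by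
  classical
  obtain ⟨s, hs⟩ := (G.strongPow m).exists_isNIndepSet_indepNum
  obtain ⟨t, ht⟩ := (G.strongPow n).exists_isNIndepSet_indepNum
  have hinj : Function.Injective
      (fun p : (Fin m → V) × (Fin n → V) => (Fin.append p.1 p.2 : Fin (m + n) → V)) :=
    fun p q h => (Fin.appendEquiv m n).injective h
  have key : (G.strongPow (m + n)).IsIndepSet
      (((s ×ˢ t).map ⟨_, hinj⟩ : Finset (Fin (m + n) → V)) : Set (Fin (m + n) → V)) := by
    rw [isIndepSet_iff]
    intro x hx y hy _ hadj
    simp only [Finset.coe_map, Set.mem_image, Finset.mem_coe, Finset.mem_product] at hx hy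
    obtain ⟨⟨a, b⟩, ⟨ha, hb⟩, rfl⟩ := hx
    obtain ⟨⟨a', b'⟩, ⟨ha', hb'⟩, rfl⟩ := hy
    obtain ⟨hne, hadj⟩ := hadj
    simp only [Function.Embedding.coeFn_mk] at hadj hne ha hb ha' hb'
    have h1 : a = a' := by
      by_contra hab
      refine hs.isIndepSet ha ha' hab ⟨hab, fun i => ?_⟩
      simpa using hadj (Fin.castAdd n i)
    have h2 : b = b' := by
      by_contra hab
      refine ht.isIndepSet hb hb' hab ⟨hab, fun i => ?_⟩
      simpa using hadj (Fin.natAdd m i)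
    exact hne (by rw [h1, h2])
  have := key.card_le_indepNum
  rwa [Finset.card_map, Finset.card_product, hs.card_eq, ht.card_eq] at this

theorem bddAbove_shannonCapacity {V : Type*} [Fintype V] (G : SimpleGraph V) :
    BddAbove (Set.range fun k : ℕ+ =>
      ((G.strongPow k).indepNum : ℝ) ^ (1 / ((k : ℕ) : ℝ))) := by
  refine ⟨Fintype.card V, ?_⟩
  rintro _ ⟨k, rfl⟩
  have h : ((G.strongPow k).indepNum : ℝ) ≤ (Fintype.card V : ℝ) ^ (k : ℕ) := by
    exact_mod_cast G.indepNum_strongPow_le k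
  calc ((G.strongPow k).indepNum : ℝ) ^ (1 / ((k : ℕ) : ℝ))
      ≤ ((Fintype.card V : ℝ) ^ (k : ℕ)) ^ (1 / ((k : ℕ) : ℝ)) := by gcongr
    _ = Fintype.card V := by
      rw [one_div]; exact Real.pow_rpow_inv_natCast (by positivity) k.ne_zero

/-- The Shannon capacity is the limit of `α(G^k)^(1/k)`. -/
theorem tendsto_shannonCapacity {V : Type*} [Fintype V] [Nonempty V] (G : SimpleGraph V) :
    Tendsto (fun k : ℕ => ((G.strongPow k).indepNum : ℝ) ^ (1 / (k : ℝ))) atTop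
      (𝓝 G.shannonCapacity) := by
  set u : ℕ → ℝ := fun k => -Real.log (G.strongPow k).indepNum with hu
  have pos : ∀ k, (0 : ℝ) < (G.strongPow k).indepNum := fun k => by
    exact_mod_cast G.indepNum_strongPow_pos k
  have hsub : Subadditive u := fun m n => by
    have h : ((G.strongPow m).indepNum : ℝ) * (G.strongPow n).indepNum ≤
        (G.strongPow (m + n)).indepNum := by
      exact_mod_cast G.indepNum_strongPow_mul_le m n
    have := Real.log_le_log (mul_pos (pos m) (pos n)) h
    rw [Real.log_mul (pos m).ne' (pos n).ne'] at this
    simp only [hu]; linarith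
  have hexp : ∀ k, ((G.strongPow k).indepNum : ℝ) ^ (1 / (k : ℝ)) = Real.exp (-(u k / k)) := by
    intro k
    rw [Real.rpow_def_of_pos (pos k)]
    congr 1
    simp only [hu]; ring
  have hbdd : BddBelow (Set.range fun n => u n / n) := by
    refine ⟨-Real.log (Fintype.card V), ?_⟩
    rintro _ ⟨k, rfl⟩
    have hV : (1 : ℝ) ≤ Fintype.card V := by exact_mod_cast Fintype.card_pos (α := V)
    rcases Nat.eq_zero_or_pos k with rfl | hk
    · simpa using Real.log_nonneg hV
    have h : ((G.strongPow k).indepNum : ℝ) ≤ (Fintype.card V : ℝ) ^ k := by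
      exact_mod_cast G.indepNum_strongPow_le k
    have h2 := Real.log_le_log (pos k) h
    rw [Real.log_pow] at h2
    have hk' : (0 : ℝ) < k := by exact_mod_cast hk
    simp only [hu]
    rw [le_div_iff₀ hk']
    linarith
  have hlim := (Real.continuous_exp.tendsto _).comp (hsub.tendsto_lim hbdd).neg
  have heq : G.shannonCapacity = Real.exp (-hsub.lim) := by
    apply le_antisymm
    · refine ciSup_le fun k => ?_
      rw [hexp]
      exact Real.exp_le_exp.2 (neg_le_neg (hsub.lim_le_div hbdd k.ne_zero))
    · refine le_of_tendsto hlim ?_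
      filter_upwards [eventually_gt_atTop 0] with k hk
      have := le_ciSup G.bddAbove_shannonCapacity ⟨k, hk⟩
      simp only [PNat.mk_coe] at this
      rw [hexp] at this
      exact this
  rw [heq]
  exact hlim.congr fun k => (hexp k).symm

/-- Orthonormal representation: unit real vectors, orthogonal at distinct nonadjacent vertices. -/
def IsOrthonormalRep {V : Type*} (G : SimpleGraph V) {d : ℕ}
    (u : V → EuclideanSpace ℝ (Fin d)) : Prop :=
  (∀ i, ‖u i‖ = 1) ∧ ∀ i j, i ≠ j → ¬ G.Adj i j → inner ℝ (u i) (u j) = 0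

/-- The value `min_c max_i 1 / (c ⬝ u_i)²` of a representation, `c` ranging over the unit vectors.
It is taken in `[0, ∞]`, where `1 / 0 = ∞`. -/
noncomputable def repValue {V : Type*} {d : ℕ} (u : V → EuclideanSpace ℝ (Fin d)) : ℝ≥0∞ :=
  ⨅ (c : EuclideanSpace ℝ (Fin d)) (_ : ‖c‖ = 1), ⨆ i, (ENNReal.ofReal (inner ℝ c (u i) ^ 2))⁻¹

/-- The Lovász theta function: the minimum value of all orthonormal representations, in any
finite dimension. The infimum is attained: see `exists_repValue_eq_lovaszTheta`. -/
noncomputable def lovaszTheta {V : Type*} (G : SimpleGraph V) : ℝ≥0∞ :=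
  ⨅ (d : ℕ) (u : V → EuclideanSpace ℝ (Fin d)) (_ : G.IsOrthonormalRep u), repValue u

/-- Both minima in the definition of the Lovász theta function are attained. -/
theorem exists_repValue_eq_lovaszTheta {V : Type*} [Fintype V] [Nonempty V]
    (G : SimpleGraph V) :
    ∃ (d : ℕ) (u : V → EuclideanSpace ℝ (Fin d)) (c : EuclideanSpace ℝ (Fin d)),
      G.IsOrthonormalRep u ∧ ‖c‖ = 1 ∧ repValue u = G.lovaszTheta ∧
      ⨆ i, (ENNReal.ofReal (inner ℝ c (u i) ^ 2))⁻¹ = G.lovaszTheta := by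
  classical
  set N := Fintype.card V + 1 with hN
  let E := EuclideanSpace ℝ (Fin N)
  let f : E × (V → E) → ℝ≥0∞ := fun p => ⨆ i, (ENNReal.ofReal (inner ℝ p.1 (p.2 i) ^ 2))⁻¹
  let K : Set (E × (V → E)) := {p | ‖p.1‖ = 1 ∧ G.IsOrthonormalRep p.2}
  have hf : LowerSemicontinuous f := by
    refine lowerSemicontinuous_iSup fun i => Continuous.lowerSemicontinuous ?_
    have : Continuous fun p : E × (V → E) => inner ℝ p.1 (p.2 i) ^ 2 := by fun_prop
    exact continuous_inv.comp (ENNReal.continuous_ofReal.comp this)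
  have hKc : IsClosed K := by
    simp only [K, IsOrthonormalRep, Set.ofPred_and, Set.ofPred_forall]
    refine (isClosed_eq (by fun_prop) (by fun_prop)).inter
      ((isClosed_iInter fun i => isClosed_eq (by fun_prop) (by fun_prop)).inter
      (isClosed_iInter fun i => isClosed_iInter fun j => isClosed_iInter fun _ =>
        isClosed_iInter fun _ => isClosed_eq (by fun_prop) (by fun_prop)))
  have hKb : K ⊆ Metric.closedBall 0 1 := by
    rintro ⟨c, u⟩ ⟨h1, h2⟩
    simp only [mem_closedBall_zero_iff, Prod.norm_def, sup_le_iff]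
    exact ⟨h1.le, (pi_norm_le_iff_of_nonneg zero_le_one).2 fun i => (h2.1 i).le⟩
  have hKK : IsCompact K := (isCompact_closedBall _ _).of_isClosed_subset hKc hKb
  -- every representation, with every unit vector, can be moved isometrically into `E`
  have red : ∀ (d : ℕ) (u : V → EuclideanSpace ℝ (Fin d)) (c : EuclideanSpace ℝ (Fin d)),
      G.IsOrthonormalRep u → ‖c‖ = 1 → ∃ p ∈ K,
        f p = ⨆ i, (ENNReal.ofReal (inner ℝ c (u i) ^ 2))⁻¹ := by
    intro d u c hu hc
    let g : Option V → EuclideanSpace ℝ (Fin d) := fun o => o.elim c u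
    let S := Submodule.span ℝ (Set.range g)
    have hS : Module.finrank ℝ S ≤ Module.finrank ℝ E := by
      have := finrank_range_le_card (R := ℝ) g
      simpa [E, hN, Set.finrank] using this
    have hg : ∀ o, g o ∈ S := fun o => Submodule.subset_span ⟨o, rfl⟩
    let b := stdOrthonormalBasis ℝ S
    let b' := stdOrthonormalBasis ℝ E
    let L : S →ₗ[ℝ] E := b.toBasis.constr ℝ fun i => b' (Fin.castLE hS i)
    have hL : Orthonormal ℝ (L ∘ b.toBasis) := by
      have : L ∘ b.toBasis = b' ∘ Fin.castLE hS := by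
        funext i; simp [L]
      rw [this]
      exact b'.orthonormal.comp _ (Fin.castLE_injective hS)
    have hb : Orthonormal ℝ b.toBasis := by simp [b.orthonormal]
    let T : S →ₗᵢ[ℝ] E := L.isometryOfOrthonormal hb hL
    let gg : Option V → E := fun o => T ⟨g o, hg o⟩
    have hin : ∀ o o', inner ℝ (gg o) (gg o') = inner ℝ (g o) (g o') := fun o o' => by
      simp only [gg, T.inner_map_map, Submodule.coe_inner]
    have hno : ∀ o, ‖gg o‖ = ‖g o‖ := fun o => by
      simp only [gg, T.norm_map, Submodule.coe_norm]
    refine ⟨(gg none, fun i => gg (some i)), ⟨(hno none).trans hc, fun i => (hno _).trans (hu.1 i),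
      fun i j h1 h2 => (hin _ _).trans (hu.2 i j h1 h2)⟩, ?_⟩
    simp only [f, hin]
    rfl
  have hne : K.Nonempty := by
    obtain ⟨p, hp, -⟩ := red (Fintype.card V)
      (fun i => EuclideanSpace.single (Fintype.equivFin V i) (1 : ℝ))
      (EuclideanSpace.single (Fintype.equivFin V (Classical.arbitrary V)) (1 : ℝ))
      ⟨fun i => by simp, fun i j h _ => by
        simp [EuclideanSpace.inner_single_left, (Fintype.equivFin V).injective.ne h]⟩ (by simp)
    exact ⟨p, hp⟩
  obtain ⟨p, hpK, hp⟩ := (hf.lowerSemicontinuousOn K).exists_isMinOn hne hKK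
  have hle : f p ≤ G.lovaszTheta := by
    refine le_iInf fun d => le_iInf fun u => le_iInf fun hu => le_iInf fun c => le_iInf fun hc => ?_
    obtain ⟨q, hq, h⟩ := red d u c hu hc
    rw [← h]
    exact hp hq
  have h1 : repValue p.2 ≤ f p := iInf₂_le p.1 hpK.1
  have h2 : G.lovaszTheta ≤ repValue p.2 :=
    (iInf_le _ N).trans ((iInf_le _ p.2).trans (iInf_le _ hpK.2))
  exact ⟨N, p.2, p.1, hpK.2, hpK.1, le_antisymm (h1.trans hle) h2,
    le_antisymm hle (h2.trans h1)⟩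

/-- The normalized Laplacian matrix (of a graph without isolated vertices). -/
noncomputable def normLapMatrix {V : Type*} [Fintype V] [DecidableEq V] (G : SimpleGraph V)
    [DecidableRel G.Adj] : Matrix V V ℝ :=
  Matrix.of fun i j =>
    if i = j then 1
    else if G.Adj i j then -(((G.degree i : ℝ) * (G.degree j : ℝ)) ^ (-(1 / 2 : ℝ)))
    else 0

/-- `H` is semiregular bipartite with bipartition `V₁ ∪ V₂`, vertices of `Vᵢ` having degree `rᵢ`.
The parameters are `(|V₁|, |V₂|, r₁, r₂)`. -/
def IsSemiregularBipartite {V : Type*} [Fintype V] [DecidableEq V] (H : SimpleGraph V)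
    [DecidableRel H.Adj] (V₁ V₂ : Finset V) (r₁ r₂ : ℕ) : Prop :=
  H.IsBipartiteWith (V₁ : Set V) (V₂ : Set V) ∧ V₁ ∪ V₂ = Finset.univ ∧
    (∀ v ∈ V₁, H.degree v = r₁) ∧ ∀ v ∈ V₂, H.degree v = r₂

/-- A clique covering: a set of cliques such that each edge lies in at least one of them. -/
def IsCliqueCovering {V : Type*} (G : SimpleGraph V) (ε : Finset (Finset V)) : Prop :=
  (∀ Q ∈ ε, G.IsClique (Q : Set V)) ∧ ∀ u v, G.Adj u v → ∃ Q ∈ ε, u ∈ Q ∧ v ∈ Q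

end SimpleGraph

/-- The number of members of `ε` that contain `u`. -/
def coveringDegree {V : Type*} [DecidableEq V] (ε : Finset (Finset V)) (u : V) : ℕ :=
  (ε.filter fun Q => u ∈ Q).card

/-- The set of (real) eigenvalues of a real square matrix. -/
def Matrix.eigenvalueSet {V : Type*} [Fintype V] [DecidableEq V] (M : Matrix V V ℝ) : Set ℝ :=
  {t | Module.End.HasEigenvalue (Matrix.toLin' M) t}

namespace Hypergraph

/-- Each edge has exactly `k` vertices. -/
def IsUniform {W : Type*} (H : Hypergraph W) (k : ℕ) : Prop :=
  ∀ e ∈ H.edgeSet, e.encard = k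

/-- The intersection graph: the vertices are the edges of `H`, two distinct ones being adjacent
iff they intersect. -/
def intersectionGraph {W : Type*} (H : Hypergraph W) : SimpleGraph H.edgeSet where
  Adj e f := e ≠ f ∧ ((e : Set W) ∩ (f : Set W)).Nonempty
  symm := ⟨fun _ _ h => ⟨h.1.symm, by rw [Set.inter_comm]; exact h.2⟩⟩
  loopless := ⟨fun _ h => h.1 rfl⟩

/-- A perfect matching: a set of pairwise disjoint edges that covers all vertices. -/
def IsPerfectMatching {W : Type*} (H : Hypergraph W) (P : Set (Set W)) : Prop :=
  P ⊆ H.edgeSet ∧ P.PairwiseDisjoint id ∧ ⋃₀ P = H.vertexSet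

end Hypergraph

/-! Everything follows from `|C| ≤ α ≤ Θ ≤ ϑ ≤ |C|`. The bound `Θ ≤ ϑ` is Lovász's: tensor powers of
an orthonormal representation represent `G^k`, and Bessel's inequality bounds independent sets there
(`IsOrthonormalRep.card_le_pow`). Only `ϑ ≤ |C|` depends on the condition assumed.

For it, take a positive semidefinite `M` vanishing at distinct nonadjacent pairs, with diagonal `m >
0` on `C`, and write `s_i` for the sum of row `i` over `C`. Normalised Gram vectors `x_i` of `M`
form an orthonormal representation. With the handle `y = ∑_{j ∈ C} x_j` one has `‖y‖² = |C| m` and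
`⟨x_i, y⟩ = s_i`, so the value is at most `|C|` once `m M_ii ≤ s_i²` and all `s_i > 0`
(`lovaszTheta_le_card_of_vectors`, `lovaszTheta_le_card_of_posSemidef`).

Each condition then supplies `M`: `A - τI` for adjacency eigenvalues, `μI - L` for the Laplacian,
`(μ - 1)D + A` for the normalized Laplacian, `|C| I + A` for the join, the signless Laplacian of `H`
for a semiregular bipartite `H`, and the Gram matrix of clique incidence vectors for clique
coverings and hypergraphs. -/

namespace Matrix

/-! ### Eigenvalue bounds as positive semidefiniteness -/

variable {V : Type*} [Fintype V] [DecidableEq V]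

theorem mem_eigenvalueSet_iff {M : Matrix V V ℝ} {t : ℝ} :
    t ∈ M.eigenvalueSet ↔ ∃ v, v ≠ 0 ∧ M *ᵥ v = t • v := by
  constructor
  · intro h
    obtain ⟨v, hv⟩ := Module.End.HasEigenvalue.exists_hasEigenvector h
    exact ⟨v, hv.2, by simpa using hv.apply_eq_smul⟩
  · rintro ⟨v, hv, h⟩
    exact Module.End.hasEigenvalue_of_hasEigenvector
      ⟨Module.End.mem_eigenspace_iff.2 (by simpa using h), hv⟩

theorem IsHermitian.posSemidef_of_eigenvalueSet_nonneg {M : Matrix V V ℝ} (hM : M.IsHermitian)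
    (h : ∀ t ∈ M.eigenvalueSet, 0 ≤ t) : M.PosSemidef := by
  rw [hM.posSemidef_iff_eigenvalues_nonneg]
  intro i
  refine h _ (mem_eigenvalueSet_iff.2 ⟨(hM.eigenvectorBasis i).ofLp, fun h0 => ?_,
    hM.mulVec_eigenvectorBasis i⟩)
  exact hM.eigenvectorBasis.orthonormal.ne_zero i (by ext j; exact congrFun h0 j)

theorem IsHermitian.posSemidef_sub_smul_one {M : Matrix V V ℝ} (hM : M.IsHermitian) {τ : ℝ}
    (h : τ ∈ lowerBounds M.eigenvalueSet) : (M - τ • (1 : Matrix V V ℝ)).PosSemidef := by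
  refine IsHermitian.posSemidef_of_eigenvalueSet_nonneg ?_ fun t ht => ?_
  · simpa [IsSymm, transpose_sub] using hM
  · obtain ⟨v, hv, hv'⟩ := mem_eigenvalueSet_iff.1 ht
    have : τ ≤ t + τ := h <| mem_eigenvalueSet_iff.2 ⟨v, hv, by
      rw [sub_mulVec, smul_mulVec, one_mulVec, sub_eq_iff_eq_add] at hv'
      rw [hv', add_smul]⟩
    linarith

theorem IsHermitian.posSemidef_smul_one_sub {M : Matrix V V ℝ} (hM : M.IsHermitian) {μ : ℝ}
    (h : μ ∈ upperBounds M.eigenvalueSet) : (μ • (1 : Matrix V V ℝ) - M).PosSemidef := by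
  refine IsHermitian.posSemidef_of_eigenvalueSet_nonneg ?_ fun t ht => ?_
  · simpa [IsSymm, transpose_sub] using hM
  · obtain ⟨v, hv, hv'⟩ := mem_eigenvalueSet_iff.1 ht
    have : μ - t ≤ μ := h <| mem_eigenvalueSet_iff.2 ⟨v, hv, by
      rw [sub_mulVec, smul_mulVec, one_mulVec] at hv'
      rw [sub_smul, ← hv', sub_sub_cancel]⟩
    linarith

end Matrix

/-! ### Tensor powers and the chain `α ≤ Θ ≤ ϑ` -/

namespace SimpleGraph

/-- The word-indexed tensor product of vectors. -/
noncomputable def tensorWord {ι κ : Type*} {k : ℕ} (u : ι → EuclideanSpace ℝ κ) (w : Fin k → ι) :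
    EuclideanSpace ℝ (Fin k → κ) :=
  WithLp.toLp 2 fun f => ∏ i, u (w i) (f i)

theorem inner_tensorWord {ι ι' κ : Type*} [Fintype κ] {k : ℕ}
    (u : ι → EuclideanSpace ℝ κ) (u' : ι' → EuclideanSpace ℝ κ) (w : Fin k → ι) (w' : Fin k → ι') :
    inner ℝ (tensorWord u w) (tensorWord u' w') = ∏ i, inner ℝ (u (w i)) (u' (w' i)) := by
  classical
  simp only [PiLp.inner_apply, tensorWord, Finset.prod_univ_sum, Fintype.piFinset_univ]
  refine Finset.sum_congr rfl fun f _ => ?_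
  simp [Finset.prod_mul_distrib]

theorem norm_tensorWord {ι κ : Type*} [Fintype κ] {k : ℕ} (u : ι → EuclideanSpace ℝ κ)
    (hu : ∀ i, ‖u i‖ = 1) (w : Fin k → ι) : ‖tensorWord u w‖ = 1 := by
  have h : inner ℝ (tensorWord u w) (tensorWord u w) = 1 := by
    rw [inner_tensorWord]
    simp [hu]
  rw [real_inner_self_eq_norm_sq] at h
  exact (pow_eq_one_iff_of_nonneg (norm_nonneg _) two_ne_zero).1 h

variable {V : Type*} {G : SimpleGraph V}

/-- Two distinct words of an independent set have distinct nonadjacent letters in some coordinate,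
so one factor of the inner product of their tensor words is zero. Hence these tensor words are
orthonormal. Each has squared inner product at least `t⁻ᵏ` with the unit vector `c^{⊗k}`, and
Bessel's inequality leaves room for at most `tᵏ` of them. -/
theorem IsOrthonormalRep.card_le_pow {d : ℕ} {u : V → EuclideanSpace ℝ (Fin d)}
    (hu : G.IsOrthonormalRep u) {c : EuclideanSpace ℝ (Fin d)} (hc : ‖c‖ = 1) {t : ℝ} (ht0 : 0 ≤ t)
    (ht : ∀ i, 1 ≤ t * inner ℝ c (u i) ^ 2) {k : ℕ} {S : Finset (Fin k → V)}
    (hS : (G.strongPow k).IsIndepSet (S : Set (Fin k → V))) : (S.card : ℝ) ≤ t ^ k := by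
  have horth : Orthonormal ℝ fun w : S => tensorWord u (w : Fin k → V) := by
    refine ⟨fun w => norm_tensorWord u hu.1 _, fun w w' hww => ?_⟩
    have hne : (w : Fin k → V) ≠ w' := fun h => hww (Subtype.ext h)
    have hnadj : ¬ (G.strongPow k).Adj w w' := hS w.2 w'.2 hne
    simp only [strongPow, not_and, not_forall, not_or] at hnadj
    obtain ⟨i, hi, hi'⟩ := hnadj hne
    change inner ℝ (tensorWord u (w : Fin k → V)) (tensorWord u (w' : Fin k → V)) = 0
    rw [inner_tensorWord]
    exact Finset.prod_eq_zero (Finset.mem_univ i) (hu.2 _ _ hi hi')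
  -- This is `c^{⊗k}`, seen as a tensor word over a one-letter alphabet.
  set cc : EuclideanSpace ℝ (Fin k → Fin d) := tensorWord (fun _ : Unit => c) fun _ => ()
  have hcc : ‖cc‖ = 1 := norm_tensorWord _ (fun _ => hc) _
  have hbessel := horth.sum_inner_products_le cc (s := Finset.univ)
  rw [hcc, one_pow] at hbessel
  have hterm : ∀ w : Fin k → V, 1 ≤ t ^ k * ‖inner ℝ (tensorWord u w) cc‖ ^ 2 := by
    intro w
    rw [real_inner_comm, inner_tensorWord, Real.norm_eq_abs, sq_abs, ← Finset.prod_pow]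
    have htk : t ^ k = ∏ _i : Fin k, t := by simp
    rw [htk, ← Finset.prod_mul_distrib]
    calc (1 : ℝ) = ∏ _i : Fin k, (1 : ℝ) := by simp
      _ ≤ _ := Finset.prod_le_prod (fun _ _ => zero_le_one) fun i _ => ht (w i)
  calc (S.card : ℝ) = ∑ _w : S, (1 : ℝ) := by simp
    _ ≤ ∑ w : S, t ^ k * ‖inner ℝ (tensorWord u (w : Fin k → V)) cc‖ ^ 2 :=
      Finset.sum_le_sum fun w _ => hterm w
    _ = t ^ k * ∑ w : S, ‖inner ℝ (tensorWord u (w : Fin k → V)) cc‖ ^ 2 := by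
      rw [Finset.mul_sum]
    _ ≤ t ^ k := mul_le_of_le_one_right (pow_nonneg ht0 k) hbessel

/-- `⟨c, u i⟩⁻² ≤ t` in `[0, ∞]`, without the conventions on division. -/
theorem inv_ofReal_sq_le_iff {x t : ℝ} :
    (ENNReal.ofReal (x ^ 2))⁻¹ ≤ ENNReal.ofReal t ↔ 1 ≤ t * x ^ 2 := by
  rw [ENNReal.inv_le_iff_le_mul (by simp) (by simp), ← ENNReal.ofReal_mul (sq_nonneg x),
    ENNReal.one_le_ofReal, mul_comm]

theorem indepNum_strongPow_le_lovaszTheta_pow [Fintype V] [Nonempty V] (G : SimpleGraph V)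
    {k : ℕ} (hk : k ≠ 0) : ((G.strongPow k).indepNum : ℝ≥0∞) ≤ G.lovaszTheta ^ k := by
  classical
  obtain ⟨d, u, c, hu, hc, -, h⟩ := G.exists_repValue_eq_lovaszTheta
  -- An infinite value makes the bound trivial, as `⊤ ^ k = ⊤` for `k ≠ 0`.
  rcases eq_or_ne G.lovaszTheta ⊤ with htop | htop
  · simp [htop, hk]
  obtain ⟨S, hS⟩ := (G.strongPow k).exists_isNIndepSet_indepNum
  have hof : ENNReal.ofReal G.lovaszTheta.toReal = G.lovaszTheta := ENNReal.ofReal_toReal htop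
  have ht : ∀ i, 1 ≤ G.lovaszTheta.toReal * inner ℝ c (u i) ^ 2 := fun i => by
    rw [← inv_ofReal_sq_le_iff, hof, ← h]
    exact le_iSup (fun i => (ENNReal.ofReal (inner ℝ c (u i) ^ 2))⁻¹) i
  have := hu.card_le_pow hc ENNReal.toReal_nonneg ht hS.isIndepSet
  rw [← hS.card_eq, ← hof, ← ENNReal.ofReal_pow ENNReal.toReal_nonneg, ← ENNReal.ofReal_natCast]
  exact ENNReal.ofReal_le_ofReal this

theorem shannonCapacity_le_of_lovaszTheta_le [Fintype V] [Nonempty V] (G : SimpleGraph V) {t : ℝ}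
    (ht : 0 ≤ t) (h : G.lovaszTheta ≤ ENNReal.ofReal t) : G.shannonCapacity ≤ t := by
  refine ciSup_le fun k => ?_
  have hk : ((G.strongPow k).indepNum : ℝ) ≤ t ^ (k : ℕ) := by
    have := (G.indepNum_strongPow_le_lovaszTheta_pow k.ne_zero).trans (pow_le_pow_left' h k)
    rwa [← ENNReal.ofReal_pow ht, ← ENNReal.ofReal_natCast,
      ENNReal.ofReal_le_ofReal_iff (by positivity)] at this
  calc ((G.strongPow k).indepNum : ℝ) ^ (1 / ((k : ℕ) : ℝ))
      ≤ (t ^ (k : ℕ)) ^ (1 / ((k : ℕ) : ℝ)) := by gcongr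
    _ = t := by rw [one_div]; exact Real.pow_rpow_inv_natCast ht k.ne_zero

theorem indepNum_le_indepNum_strongPow_one [Fintype V] (G : SimpleGraph V) :
    G.indepNum ≤ (G.strongPow 1).indepNum := by
  classical
  obtain ⟨S, hS⟩ := G.exists_isNIndepSet_indepNum
  have hinj : Function.Injective fun (v : V) (_ : Fin 1) => v := fun v w h => congrFun h 0
  have key : (G.strongPow 1).IsIndepSet
      ((S.map ⟨_, hinj⟩ : Finset (Fin 1 → V)) : Set (Fin 1 → V)) := by
    rw [isIndepSet_iff]
    intro x hx y hy hxy hadj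
    simp only [Finset.coe_map, Set.mem_image, Finset.mem_coe, Function.Embedding.coeFn_mk] at hx hy
    obtain ⟨v, hv, rfl⟩ := hx
    obtain ⟨w, hw, rfl⟩ := hy
    have hvw : v ≠ w := fun h => hxy (by rw [h])
    exact hS.isIndepSet hv hw hvw ((hadj.2 0).resolve_left hvw)
  have := key.card_le_indepNum
  rwa [Finset.card_map, hS.card_eq] at this

theorem indepNum_le_shannonCapacity [Fintype V] (G : SimpleGraph V) :
    (G.indepNum : ℝ) ≤ G.shannonCapacity := by
  refine le_trans ?_ (le_ciSup G.bddAbove_shannonCapacity 1)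
  simpa using G.indepNum_le_indepNum_strongPow_one

/-- The sandwich `|C| ≤ α ≤ Θ ≤ ϑ` closes up, so only `ϑ ≤ |C|` remains to be shown under each
condition. -/
theorem eq_card_of_lovaszTheta_le_card [Fintype V] [Nonempty V] {G : SimpleGraph V} {C : Finset V}
    (hC : G.IsIndepSet (C : Set V)) (h : G.lovaszTheta ≤ C.card) :
    G.indepNum = C.card ∧ G.shannonCapacity = (C.card : ℝ) ∧ G.lovaszTheta = (C.card : ℝ≥0∞) := by
  have h1 : C.card ≤ G.indepNum := hC.card_le_indepNum
  have h2 := G.indepNum_le_shannonCapacity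
  have h3 : G.shannonCapacity ≤ C.card :=
    G.shannonCapacity_le_of_lovaszTheta_le (Nat.cast_nonneg _) (by simpa using h)
  have h4 : G.indepNum ≤ C.card := by exact_mod_cast h2.trans h3
  have h5 : (G.indepNum : ℝ≥0∞) ≤ G.lovaszTheta := by
    have := G.indepNum_strongPow_le_lovaszTheta_pow one_ne_zero
    rw [pow_one] at this
    exact le_trans (by exact_mod_cast G.indepNum_le_indepNum_strongPow_one) this
  have h6 : G.indepNum = C.card := le_antisymm h4 h1
  rw [h6] at h2 h5
  exact ⟨h6, le_antisymm h3 h2, le_antisymm h h5⟩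

/-! ### The criterion for `ϑ ≤ |C|` -/

/-- A representation in any finite-dimensional inner product space bounds the theta function. -/
theorem lovaszTheta_le_of_orthonormalRep {E : Type*} [NormedAddCommGroup E]
    [InnerProductSpace ℝ E] [FiniteDimensional ℝ E] {u : V → E} (hu : ∀ i, ‖u i‖ = 1)
    (hu' : ∀ i j, i ≠ j → ¬ G.Adj i j → inner ℝ (u i) (u j) = 0) {c : E} (hc : ‖c‖ = 1) {t : ℝ}
    (ht : ∀ i, 1 ≤ t * inner ℝ c (u i) ^ 2) :
    G.lovaszTheta ≤ ENNReal.ofReal t := by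
  let T := (stdOrthonormalBasis ℝ E).repr
  have hrep : G.IsOrthonormalRep fun i => T (u i) :=
    ⟨fun i => by rw [T.norm_map, hu], fun i j hij h => by rw [T.inner_map_map, hu' i j hij h]⟩
  refine (iInf_le _ _).trans ((iInf_le _ _).trans ((iInf_le _ hrep).trans
    ((iInf₂_le (T c) (by rw [T.norm_map, hc])).trans (iSup_le fun i => ?_))))
  rw [inv_ofReal_sq_le_iff, T.inner_map_map]
  exact ht i

/-- The handle is the direction of `y = ∑_{j ∈ C} x_j`. Since `‖y‖² = |C| m`, the inequality `⟨x_i,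
y⟩² ≥ m ‖x_i‖²` says that the normalised vectors have squared inner product at least `1/|C|`. Inside
`C` it is an equality. -/
theorem lovaszTheta_le_card_of_vectors {E : Type*} [NormedAddCommGroup E] [InnerProductSpace ℝ E]
    [FiniteDimensional ℝ E] [Nonempty V] {C : Finset V} (hC : G.IsIndepSet (C : Set V)) (x : V → E)
    (hx : ∀ i j, i ≠ j → ¬ G.Adj i j → inner ℝ (x i) (x j) = 0) {m : ℝ} (hm : 0 < m)
    (hxC : ∀ i ∈ C, inner ℝ (x i) (x i) = m)
    (hpos : ∀ i ∉ C, 0 < ∑ j ∈ C, inner ℝ (x i) (x j))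
    (hle : ∀ i ∉ C, m * inner ℝ (x i) (x i) ≤ (∑ j ∈ C, inner ℝ (x i) (x j)) ^ 2) :
    G.lovaszTheta ≤ C.card := by
  classical
  set y : E := ∑ j ∈ C, x j with hy
  -- Independence of `C` makes its vectors pairwise orthogonal, so only the diagonal term survives.
  have hrow : ∀ i ∈ C, inner ℝ (x i) y = m := fun i hi => by
    rw [hy, inner_sum, Finset.sum_eq_single_of_mem i hi, hxC i hi]
    exact fun j hj hji => hx i j hji.symm (hC hi hj hji.symm)
  have hpos' : ∀ i, 0 < inner ℝ (x i) y := fun i => by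
    by_cases hi : i ∈ C
    · rwa [hrow i hi]
    · rw [hy, inner_sum]; exact hpos i hi
  have hle' : ∀ i, m * inner ℝ (x i) (x i) ≤ inner ℝ (x i) y ^ 2 := fun i => by
    by_cases hi : i ∈ C
    · rw [hrow i hi, hxC i hi, sq]
    · rw [hy, inner_sum]; exact hle i hi
  -- Positivity of `⟨x_i, y⟩` serves to exclude zero vectors, so that `x_i` and `y` can be
  -- normalised.
  have hx0 : ∀ i, ‖x i‖ ≠ 0 := fun i h => by
    have := hpos' i
    rw [norm_eq_zero.1 h, inner_zero_left] at this
    exact this.false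
  have hy0 : ‖y‖ ≠ 0 := fun h => by
    have := hpos' (Classical.arbitrary V)
    rw [norm_eq_zero.1 h, inner_zero_right] at this
    exact this.false
  have hyy : ‖y‖ ^ 2 = C.card * m := by
    rw [← real_inner_self_eq_norm_sq]
    conv_lhs => rw [hy, sum_inner, ← hy]
    rw [Finset.sum_congr rfl hrow, Finset.sum_const, nsmul_eq_mul]
  rw [← ENNReal.ofReal_natCast]
  refine lovaszTheta_le_of_orthonormalRep (u := fun i => ‖x i‖⁻¹ • x i) (c := ‖y‖⁻¹ • y)
    (fun i => ?_) (fun i j hij h => ?_) ?_ fun i => ?_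
  · rw [norm_smul, norm_inv, norm_norm, inv_mul_cancel₀ (hx0 i)]
  · rw [inner_smul_left, inner_smul_right, hx i j hij h, mul_zero, mul_zero]
  · rw [norm_smul, norm_inv, norm_norm, inv_mul_cancel₀ hy0]
  · have hxi := hx0 i
    have h1 : 0 < ‖y‖ ^ 2 * ‖x i‖ ^ 2 := by positivity
    have h2 := hle' i
    rw [real_inner_self_eq_norm_sq] at h2
    rw [real_inner_smul_left, real_inner_smul_right, real_inner_comm]
    have h3 : (C.card : ℝ) * (‖y‖⁻¹ * (‖x i‖⁻¹ * inner ℝ (x i) y)) ^ 2 =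
        C.card * inner ℝ (x i) y ^ 2 / (‖y‖ ^ 2 * ‖x i‖ ^ 2) := by field_simp
    rw [h3, le_div_iff₀ h1, one_mul, hyy, mul_assoc]
    exact mul_le_mul_of_nonneg_left h2 (Nat.cast_nonneg _)

/-- A factorisation `M = X* X` turns the columns of `X` into Gram vectors for `M`. -/
theorem lovaszTheta_le_card_of_posSemidef [Fintype V] [Nonempty V] {C : Finset V}
    (hC : G.IsIndepSet (C : Set V)) {M : Matrix V V ℝ} (hM : M.PosSemidef)
    (hsupp : ∀ i j, i ≠ j → ¬ G.Adj i j → M i j = 0) {m : ℝ} (hm : 0 < m)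
    (hMC : ∀ i ∈ C, M i i = m) (hpos : ∀ i ∉ C, 0 < ∑ j ∈ C, M i j)
    (hle : ∀ i ∉ C, m * M i i ≤ (∑ j ∈ C, M i j) ^ 2) : G.lovaszTheta ≤ C.card := by
  classical
  open scoped MatrixOrder in
  obtain ⟨X, hX⟩ := CStarAlgebra.nonneg_iff_eq_star_mul_self.mp hM.nonneg
  let x : V → EuclideanSpace ℝ V := fun i => WithLp.toLp 2 fun k => X k i
  have hin : ∀ i j, inner ℝ (x i) (x j) = M i j := fun i j => by
    rw [hX]
    simp [x, PiLp.inner_apply, Matrix.mul_apply, Matrix.star_apply, mul_comm]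
  exact lovaszTheta_le_card_of_vectors hC x (by simpa only [hin] using hsupp) hm
    (by simpa only [hin] using hMC) (by simpa only [hin] using hpos)
    (by simpa only [hin] using hle)

end SimpleGraph

/-! ### Specialised forms of the criterion -/

namespace SimpleGraph

theorem sum_adjMatrix_eq_card {V : Type*} (G : SimpleGraph V) [DecidableRel G.Adj] (C : Finset V) (v : V) :
    ∑ j ∈ C, G.adjMatrix ℝ v j = (C.filter fun u => G.Adj v u).card := by
  simp [adjMatrix_apply]

/-- A positive semidefinite matrix of trace zero is zero. This disposes of the degenerate spectral
cases. -/
theorem not_adj_of_posSemidef_adjMatrix {V : Type*} [Fintype V] {G : SimpleGraph V}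
    [DecidableRel G.Adj] (h : (G.adjMatrix ℝ).PosSemidef) (u v : V) :
    ¬ G.Adj u v := by
  have h0 : G.adjMatrix ℝ = 0 := h.trace_eq_zero_iff.1 (by simp [Matrix.trace])
  have := congrFun (congrFun h0 u) v
  simpa [adjMatrix_apply] using this

theorem lovaszTheta_le_card_univ {V : Type*} [Fintype V] [DecidableEq V] [Nonempty V]
    {G : SimpleGraph V} {C : Finset V} (hC : G.IsIndepSet (C : Set V))
    (h : ∀ v, v ∈ C) : G.lovaszTheta ≤ C.card :=
  lovaszTheta_le_card_of_posSemidef hC (M := 1) .one (fun _ _ hij _ => Matrix.one_apply_ne hij)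
    one_pos (fun _ _ => Matrix.one_apply_eq _) (fun i hi => absurd (h i) hi)
    fun i hi => absurd (h i) hi

/-- The criterion for matrices `D + A`, `D` diagonal and `A` the adjacency matrix of a spanning
subgraph. -/
theorem lovaszTheta_le_card_of_diagonal_add_adjMatrix {V : Type*} [Fintype V]
    [DecidableEq V] [Nonempty V] {G : SimpleGraph V} {C : Finset V}
    (hC : G.IsIndepSet (C : Set V)) (H : SimpleGraph V) [DecidableRel H.Adj] (hH : H ≤ G) {d : V → ℝ}
    (hM : (Matrix.diagonal d + H.adjMatrix ℝ).PosSemidef) {m : ℝ} (hm : 0 < m)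
    (hdC : ∀ i ∈ C, d i = m) (hpos : ∀ i ∉ C, 0 < (C.filter fun u => H.Adj i u).card)
    (hle : ∀ i ∉ C, m * d i ≤ ((C.filter fun u => H.Adj i u).card : ℝ) ^ 2) :
    G.lovaszTheta ≤ C.card := by
  have hrow : ∀ i ∉ C, ∑ j ∈ C, (Matrix.diagonal d + H.adjMatrix ℝ) i j =
      (C.filter fun u => H.Adj i u).card := fun i hi => by
    rw [← sum_adjMatrix_eq_card]
    refine Finset.sum_congr rfl fun j hj => ?_
    rw [Matrix.add_apply, Matrix.diagonal_apply_ne _ (ne_of_mem_of_not_mem hj hi).symm, zero_add]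
  refine lovaszTheta_le_card_of_posSemidef hC hM (fun i j hij h => ?_) hm (fun i hi => ?_)
    (fun i hi => ?_) fun i hi => ?_
  · have hHij : ¬ H.Adj i j := fun h' => h (hH h')
    simp [hij, adjMatrix_apply, hHij]
  · simp [hdC i hi]
  · rw [hrow i hi]; exact_mod_cast hpos i hi
  · rw [hrow i hi]; simpa using hle i hi

/-- The criterion for the clique incidence vectors of a family of cliques, each meeting `C` in one
vertex. -/
theorem lovaszTheta_le_card_of_cliques {V : Type*} [DecidableEq V] [Nonempty V] {G : SimpleGraph V}
    {C : Finset V} (hC : G.IsIndepSet (C : Set V))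
    {ι : Type*} [Fintype ι] (Q : ι → Finset V) (hQ : ∀ a, G.IsClique (Q a : Set V))
    (hpos : ∀ u, 0 < (Finset.univ.filter fun a => u ∈ Q a).card)
    (hmin : ∀ v ∈ C, ∀ u, (Finset.univ.filter fun a => v ∈ Q a).card ≤
      (Finset.univ.filter fun a => u ∈ Q a).card)
    (hone : ∀ a, (C ∩ Q a).card = 1) : G.lovaszTheta ≤ C.card := by
  classical
  set deg : V → ℕ := fun u => (Finset.univ.filter fun a => u ∈ Q a).card
  have hdeg : ∀ u, (deg u : ℝ) = ∑ a, if u ∈ Q a then 1 else 0 := fun u => by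
    simp only [deg, Finset.card_filter]
    push_cast
    rfl
  let x : V → EuclideanSpace ℝ ι := fun v => WithLp.toLp 2 fun a => if v ∈ Q a then 1 else 0
  have hin : ∀ u v, inner ℝ (x u) (x v) =
      ∑ a, (if u ∈ Q a then (if v ∈ Q a then 1 else 0) else 0 : ℝ) := fun u v => by
    rw [PiLp.inner_apply]
    refine Finset.sum_congr rfl fun a _ => ?_
    by_cases hu : u ∈ Q a <;> by_cases hv : v ∈ Q a <;> simp [x, hu, hv]
  have hself : ∀ u, inner ℝ (x u) (x u) = deg u := fun u => by
    rw [hin, hdeg]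
    exact Finset.sum_congr rfl fun a _ => by by_cases hu : u ∈ Q a <;> simp [hu]
  -- Each clique through `u` contains exactly one vertex of `C` and so contributes exactly 1. The
  -- criterion thus becomes `deg v * deg u ≤ deg u ^ 2` with `v ∈ C`, which is minimality of `deg
  -- v`.
  have hrow : ∀ u, ∑ v ∈ C, inner ℝ (x u) (x v) = deg u := fun u => by
    rw [Finset.sum_congr rfl fun v _ => hin u v, Finset.sum_comm, hdeg]
    refine Finset.sum_congr rfl fun a _ => ?_
    by_cases hu : u ∈ Q a
    · have := hone a
      simp [hu, Finset.sum_ite_mem, this]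
    · simp [hu]
  have hCne : C.Nonempty := by
    obtain ⟨a, -⟩ := Finset.card_pos.1 (hpos (Classical.arbitrary V))
    obtain ⟨v, hv⟩ := Finset.card_pos.1 ((hone a).symm ▸ one_pos : 0 < (C ∩ Q a).card)
    exact ⟨v, (Finset.mem_inter.1 hv).1⟩
  obtain ⟨v, hv⟩ := hCne
  refine lovaszTheta_le_card_of_vectors hC x (fun i j hij h => ?_) (m := deg v)
    (by exact_mod_cast hpos v) (fun i hi => ?_) (fun i _ => ?_) fun i _ => ?_
  · rw [hin]
    refine Finset.sum_eq_zero fun a _ => ?_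
    by_cases hi : i ∈ Q a
    · have hj : j ∉ Q a := fun hj => h (hQ a hi hj hij)
      simp [hj]
    · simp [hi]
  · rw [hself]
    exact_mod_cast le_antisymm (hmin i hi v) (hmin v hv i)
  · rw [hrow]; exact_mod_cast hpos i
  · rw [hrow, hself, sq]
    exact_mod_cast Nat.mul_le_mul_right _ (hmin v hv i)

/-! ### Spectral conditions, joins and the signless Laplacian -/

section Spectral

variable {V : Type*} [Fintype V] [DecidableEq V] {G : SimpleGraph V} [DecidableRel G.Adj]
  {C : Finset V}

theorem lovaszTheta_le_card_of_adjacency [Nonempty V] (hC : G.IsIndepSet (C : Set V)) {τ : ℝ}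
    (hτ : IsLeast (G.adjMatrix ℝ).eigenvalueSet τ) (hneg : τ < 0)
    (h : ∀ v ∉ C, -τ ≤ ((C.filter fun u => G.Adj v u).card : ℝ)) : G.lovaszTheta ≤ C.card := by
  have hM := (G.isHermitian_adjMatrix ℝ).posSemidef_sub_smul_one hτ.2
  have heq : G.adjMatrix ℝ - τ • (1 : Matrix V V ℝ) =
      Matrix.diagonal (fun _ => -τ) + G.adjMatrix ℝ := by
    rw [sub_eq_neg_add, ← neg_smul, Matrix.smul_one_eq_diagonal]
  rw [heq] at hM
  refine lovaszTheta_le_card_of_diagonal_add_adjMatrix hC G le_rfl hM (neg_pos.2 hneg)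
    (fun _ _ => rfl) (fun i hi => ?_) fun i hi => ?_
  · exact_mod_cast (neg_pos.2 hneg).trans_le (h i hi)
  · rw [← sq]
    exact pow_le_pow_left₀ (neg_pos.2 hneg).le (h i hi) 2

/-- Beyond `τ < 0`, the zero diagonal of `A` leaves only `τ = 0`. Then `A` is positive semidefinite
and `G` has no edges, so a vertex outside `C` could not have more than `-τ = 0` neighbours in `C`;
hence `C` is everything. -/
theorem lovaszTheta_le_card_of_gt_adjacency [Nonempty V] (hC : G.IsIndepSet (C : Set V)) {τ : ℝ}
    (hτ : IsLeast (G.adjMatrix ℝ).eigenvalueSet τ)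
    (h : ∀ v ∉ C, -τ < ((C.filter fun u => G.Adj v u).card : ℝ)) : G.lovaszTheta ≤ C.card := by
  rcases lt_or_ge τ 0 with hneg | hnn
  · exact lovaszTheta_le_card_of_adjacency hC hτ hneg fun v hv => (h v hv).le
  have hM := (G.isHermitian_adjMatrix ℝ).posSemidef_sub_smul_one hτ.2
  have hτ0 : τ = 0 := by
    have := hM.diag_nonneg (i := Classical.arbitrary V)
    simp at this
    linarith
  rw [hτ0, zero_smul, sub_zero] at hM
  refine lovaszTheta_le_card_univ hC fun v => by_contra fun hv => ?_
  have := h v hv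
  simp [not_adj_of_posSemidef_adjMatrix hM, hτ0] at this

/-- The diagonal `μ - d_v` of `μI - L` attains its maximum `m = μ - δ` on `C`, and the row sums over
`C` outside `C` are also `m`. Hence `m (μ - d_v) ≤ m²`. -/
theorem lovaszTheta_le_card_of_laplacian [Nonempty V] (hC : G.IsIndepSet (C : Set V)) {μ : ℝ}
    (hμ : IsGreatest (G.lapMatrix ℝ).eigenvalueSet μ) (hpos : 0 < μ)
    (hdeg : ∀ u ∈ C, G.degree u = G.minDegree)
    (h : ∀ v ∉ C, ((C.filter fun u => G.Adj v u).card : ℝ) = μ - (G.minDegree : ℝ)) :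
    G.lovaszTheta ≤ C.card := by
  have hM := (G.posSemidef_lapMatrix ℝ).isHermitian.posSemidef_smul_one_sub hμ.2
  have heq : μ • (1 : Matrix V V ℝ) - G.lapMatrix ℝ =
      Matrix.diagonal (fun i => μ - G.degree i) + G.adjMatrix ℝ := by
    rw [lapMatrix, degMatrix, Matrix.smul_one_eq_diagonal, ← sub_add, Matrix.diagonal_sub]
  have hmin : ∀ v, (G.minDegree : ℝ) ≤ G.degree v := fun v => by
    exact_mod_cast G.minDegree_le_degree v
  have hle : ∀ v, (G.degree v : ℝ) ≤ μ := fun v => by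
    have := (heq ▸ hM).diag_nonneg (i := v)
    simpa using this
  -- If `μ ≤ δ`, the nonnegative diagonal of `μI - L` vanishes, so the matrix itself does. But it
  -- maps the all-ones vector to `μ` times itself.
  have hlt : (G.minDegree : ℝ) < μ := by
    by_contra hge
    have h0 : μ • (1 : Matrix V V ℝ) - G.lapMatrix ℝ = 0 := by
      refine hM.trace_eq_zero_iff.1 ?_
      rw [heq]
      refine Finset.sum_eq_zero fun v _ => ?_
      have := hmin v
      have := hle v
      simp
      linarith
    have h1 := congrFun (congrArg (Matrix.mulVec · fun _ => (1 : ℝ)) h0) (Classical.arbitrary V)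
    rw [Matrix.sub_mulVec, lapMatrix_mulVec_const_eq_zero] at h1
    simp [Matrix.smul_mulVec, hpos.ne'] at h1
  rw [heq] at hM
  refine lovaszTheta_le_card_of_diagonal_add_adjMatrix hC G le_rfl hM (sub_pos.2 hlt)
    (fun i hi => by simp only [hdeg i hi]) (fun i hi => ?_) fun i hi => ?_
  · have := sub_pos.2 hlt
    rw [← h i hi] at this
    exact_mod_cast this
  · rw [h i hi, sq]
    exact mul_le_mul_of_nonneg_left (sub_le_sub_left (hmin i) μ) (sub_pos.2 hlt).le

theorem isHermitian_normLapMatrix (G : SimpleGraph V) [DecidableRel G.Adj] :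
    G.normLapMatrix.IsHermitian := by
  ext i j
  simp [normLapMatrix, G.adj_comm i j, eq_comm (a := i) (b := j), mul_comm]

theorem lovaszTheta_le_card_of_normalizedLaplacian [Nonempty V] (hC : G.IsIndepSet (C : Set V))
    {μ : ℝ} (hμ : IsGreatest G.normLapMatrix.eigenvalueSet μ) (hpos : 0 < G.minDegree)
    (hdeg : ∀ u ∈ C, G.degree u = G.minDegree)
    (h : ∀ v ∉ C, ((C.filter fun u => G.Adj v u).card : ℝ) = (μ - 1) * (G.degree v : ℝ)) :
    G.lovaszTheta ≤ C.card := by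
  have hmin : ∀ v, (G.minDegree : ℝ) ≤ G.degree v := fun v => by
    exact_mod_cast G.minDegree_le_degree v
  have hmin0 : (0 : ℝ) < G.minDegree := by exact_mod_cast hpos
  have hd : ∀ v, (0 : ℝ) < G.degree v := fun v => hmin0.trans_le (hmin v)
  have hM := (G.isHermitian_normLapMatrix.posSemidef_smul_one_sub
    hμ.2).mul_mul_conjTranspose_same (Matrix.diagonal fun v => √(G.degree v : ℝ))
  -- Conjugation by `D^{1/2}` clears the degree weights from the edge entries.
  have heq : (Matrix.diagonal fun v => √(G.degree v : ℝ)) *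
      (μ • (1 : Matrix V V ℝ) - G.normLapMatrix) *
        (Matrix.diagonal fun v => √(G.degree v : ℝ)).conjTranspose =
      Matrix.diagonal (fun v => (μ - 1) * (G.degree v : ℝ)) + G.adjMatrix ℝ := by
    ext i j
    rw [Matrix.diagonal_conjTranspose, Matrix.mul_diagonal, Matrix.diagonal_mul]
    rcases eq_or_ne i j with rfl | hij
    · have := Real.mul_self_sqrt (hd i).le
      simp [normLapMatrix]
      linear_combination (μ - 1) * this
    · by_cases hadj : G.Adj i j
      · have h1 : ((G.degree i : ℝ) * G.degree j) ^ (-(1 / 2 : ℝ)) =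
            (√(G.degree i : ℝ) * √(G.degree j : ℝ))⁻¹ := by
          rw [Real.rpow_neg (mul_pos (hd i) (hd j)).le, ← Real.sqrt_eq_rpow,
            Real.sqrt_mul (hd i).le]
        have h2 := (Real.sqrt_pos.2 (hd i)).ne'
        have h3 := (Real.sqrt_pos.2 (hd j)).ne'
        simp only [normLapMatrix, Matrix.sub_apply, Matrix.smul_apply, Matrix.one_apply_ne hij,
          Matrix.of_apply, hij, hadj, if_true, if_false, h1, Matrix.add_apply,
          Matrix.diagonal_apply_ne _ hij, adjMatrix_apply, Pi.star_apply, star_trivial]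
        field_simp
        simp
      · simp [normLapMatrix, hij, hadj]
  rw [heq] at hM
  -- With `μ = 1` the matrix would be `A`, forcing `G` to be edgeless against `δ > 0`.
  have hlt : 0 < μ - 1 := by
    have hge : 0 ≤ μ - 1 := by
      have := hM.diag_nonneg (i := Classical.arbitrary V)
      simp only [Matrix.add_apply, Matrix.diagonal_apply_eq, adjMatrix_apply, SimpleGraph.irrefl,
        if_false, add_zero] at this
      exact nonneg_of_mul_nonneg_left this (hd _)
    refine lt_of_le_of_ne hge fun h0 => ?_
    simp only [← h0, zero_mul, Matrix.diagonal_zero, zero_add] at hM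
    have hdpos := hpos.trans_le (G.minDegree_le_degree (Classical.arbitrary V))
    obtain ⟨w, hw⟩ := (G.degree_pos_iff_exists_adj _).1 hdpos
    exact not_adj_of_posSemidef_adjMatrix hM _ _ hw
  refine lovaszTheta_le_card_of_diagonal_add_adjMatrix hC G le_rfl hM (mul_pos hlt hmin0)
    (fun i hi => by simp only [hdeg i hi]) (fun i hi => ?_) fun i hi => ?_
  · have := mul_pos hlt (hd i)
    rw [← h i hi] at this
    exact_mod_cast this
  · rw [h i hi, sq]
    exact mul_le_mul_of_nonneg_right (mul_le_mul_of_nonneg_left (hmin i) hlt.le)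
      (mul_pos hlt (hd i)).le

/-- With `J` the all-ones matrix, `|C| I + A` is the sum of the Laplacian of the complement, a
diagonal matrix with entries `|C| - 1 - deg_{Gᶜ} v ≥ 0`, and `J`. All three are positive
semidefinite. Outside `C` the criterion is the equality `|C| * |C| = |C|²`. -/
theorem lovaszTheta_le_card_of_degree_compl_lt [Nonempty V] (hC : G.IsIndepSet (C : Set V))
    (hadj : ∀ v ∉ C, ∀ u ∈ C, G.Adj v u) (h : ∀ v, Gᶜ.degree v < C.card) :
    G.lovaszTheta ≤ C.card := by
  have hc : 0 < C.card := (Nat.zero_le _).trans_lt (h (Classical.arbitrary V))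
  have hM : (Matrix.diagonal (fun _ => (C.card : ℝ)) + G.adjMatrix ℝ).PosSemidef := by
    have h1 := Gᶜ.posSemidef_lapMatrix ℝ
    have h2 : (Matrix.diagonal fun v => (C.card : ℝ) - 1 - Gᶜ.degree v).PosSemidef :=
      .diagonal fun v => by
        have : (Gᶜ.degree v : ℝ) + 1 ≤ C.card := by exact_mod_cast h v
        simp only [Pi.zero_apply]
        linarith
    have h3 := Matrix.posSemidef_vecMulVec_self_star (fun _ : V => (1 : ℝ))
    suffices heq : Matrix.diagonal (fun _ => (C.card : ℝ)) + G.adjMatrix ℝ =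
        Gᶜ.lapMatrix ℝ + Matrix.diagonal (fun v => (C.card : ℝ) - 1 - Gᶜ.degree v) +
          Matrix.vecMulVec (fun _ : V => (1 : ℝ)) (star fun _ : V => (1 : ℝ)) by
      rw [heq]
      exact (h1.add h2).add h3
    ext i j
    rcases eq_or_ne i j with rfl | hij
    · simp [lapMatrix, degMatrix, Matrix.vecMulVec_apply]
    · by_cases ha : G.Adj i j <;>
        simp [lapMatrix, degMatrix, hij, ha, Matrix.vecMulVec_apply]
  have hrow : ∀ i ∉ C, (C.filter fun u => G.Adj i u).card = C.card := fun i hi => by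
    rw [Finset.filter_true_of_mem fun u hu => hadj i hi u hu]
  refine lovaszTheta_le_card_of_diagonal_add_adjMatrix hC G le_rfl hM (m := C.card)
    (by exact_mod_cast hc) (fun i hi => rfl) (fun i hi => ?_) fun i hi => ?_
  · rwa [hrow i hi]
  · rw [hrow i hi, sq]

theorem lovaszTheta_le_card_of_join [Nonempty V] (hC : G.IsIndepSet (C : Set V))
    (hadj : ∀ v ∉ C, ∀ u ∈ C, G.Adj v u)
    (h : Fintype.card V ≤ 2 * C.card + (G.induce {v | v ∉ C}).minDegree) :
    G.lovaszTheta ≤ C.card := by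
  rcases C.eq_empty_or_nonempty with rfl | hne
  -- For empty `C` the hypothesis would read `|V| ≤ δ(G)`, which is impossible.
  · have : (G.induce {v : V | v ∉ (∅ : Finset V)}).minDegree < Fintype.card V := by
      have v : {v : V | v ∉ (∅ : Finset V)} := ⟨Classical.arbitrary V, by simp⟩
      refine ((minDegree_le_degree _ v).trans_lt (degree_lt_card_verts _)).trans_le ?_
      exact Fintype.card_subtype_le _
    simp at h
    omega
  refine lovaszTheta_le_card_of_degree_compl_lt hC hadj fun v => ?_
  by_cases hv : v ∈ C
  -- Non-neighbours of a vertex `v ∈ C` all lie in `C`, and `v` is not among them.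
  · rw [← card_neighborFinset_eq_degree]
    refine Finset.card_lt_card (Finset.ssubset_iff_subset_ne.2 ⟨fun w hw => ?_, fun he => ?_⟩)
    · rw [mem_neighborFinset, compl_adj] at hw
      exact by_contra fun hwC => hw.2 (hadj w hwC v hv).symm
    · rw [← he] at hv
      simp at hv
  · rw [degree_compl]
    have h1 : (G.induce {v | v ∉ C}).minDegree + C.card ≤ G.degree v := by
      have h2 := minDegree_le_degree (G.induce {v | v ∉ C}) ⟨v, hv⟩
      have h3 : (G.induce {v | v ∉ C}).degree ⟨v, hv⟩ + C.card ≤ G.degree v := by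
        rw [← card_neighborFinset_eq_degree, ← card_neighborFinset_eq_degree,
          ← Finset.card_map (Function.Embedding.subtype _), ← Finset.card_union_of_disjoint]
        · refine Finset.card_le_card fun w hw => ?_
          rw [Finset.mem_union, Finset.mem_map] at hw
          rw [mem_neighborFinset]
          rcases hw with ⟨w, hw, rfl⟩ | hw
          · simpa using hw
          · exact hadj v hv w hw
        · rw [Finset.disjoint_left]
          intro w hw hwC
          obtain ⟨w, -, rfl⟩ := Finset.mem_map.1 hw
          exact w.2 hwC
      omega
    have := hne.card_pos
    omega

/-- Changing signs on one colour class turns the Laplacian `D - A` of a bipartite graph into `D +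
A`. -/
theorem posSemidef_degMatrix_add_adjMatrix (H : SimpleGraph V) [DecidableRel H.Adj]
    {V₁ V₂ : Finset V} (hH : H.IsBipartiteWith (V₁ : Set V) (V₂ : Set V)) :
    (H.degMatrix ℝ + H.adjMatrix ℝ).PosSemidef := by
  let s : V → ℝ := fun v => if v ∈ V₁ then 1 else -1
  have h := (H.posSemidef_lapMatrix ℝ).mul_mul_conjTranspose_same (Matrix.diagonal s)
  have hdisj : ∀ v, v ∈ V₁ → v ∉ V₂ := fun v h1 h2 => Set.disjoint_left.1 hH.disjoint h1 h2
  suffices heq : H.degMatrix ℝ + H.adjMatrix ℝ =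
      Matrix.diagonal s * H.lapMatrix ℝ * (Matrix.diagonal s).conjTranspose by
    rw [heq]
    exact h
  ext i j
  rw [Matrix.diagonal_conjTranspose, Matrix.mul_diagonal, Matrix.diagonal_mul]
  rcases eq_or_ne i j with rfl | hij
  · by_cases hi : i ∈ V₁ <;> simp [lapMatrix, degMatrix, s, hi]
  · by_cases ha : H.Adj i j
    · rcases hH.mem_of_adj ha with ⟨h1, h2⟩ | ⟨h1, h2⟩
      · have h3 : j ∉ V₁ := fun h => hdisj j h h2
        have h1 : i ∈ V₁ := h1
        simp [lapMatrix, degMatrix, s, h1, h3, hij, ha]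
      · have h3 : i ∉ V₁ := fun h => hdisj i h h1
        have h2 : j ∈ V₁ := h2
        simp [lapMatrix, degMatrix, s, h2, h3, hij, ha]
    · simp [lapMatrix, degMatrix, hij, ha]

end Spectral

/-! ### Bipartite subgraphs, clique coverings and hypergraphs -/

variable {V : Type*} [DecidableEq V] {G : SimpleGraph V} {C : Finset V}

theorem lovaszTheta_le_card_of_semiregularBipartite [Fintype V] [Nonempty V] (hC : G.IsIndepSet (C : Set V))
    (H : SimpleGraph V) [DecidableRel H.Adj] (hHG : H ≤ G) (hpos : 0 < H.minDegree)
    {V₁ : Finset V} {r₁ r₂ : ℕ} (hH : H.IsSemiregularBipartite V₁ C r₁ r₂)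
    (hcard : V₁.card ≤ C.card) : G.lovaszTheta ≤ C.card := by
  obtain ⟨hb, hun, h1, h2⟩ := hH
  have hd : ∀ v, 0 < H.degree v := fun v => hpos.trans_le (H.minDegree_le_degree v)
  have hV₁ : ∀ v ∉ C, v ∈ V₁ := fun v hv => by
    have := Finset.mem_univ v
    rw [← hun, Finset.mem_union] at this
    exact this.resolve_right hv
  have hrow : ∀ v ∉ C, (C.filter fun u => H.Adj v u).card = r₁ := fun v hv => by
    rw [← h1 v (hV₁ v hv), ← card_neighborFinset_eq_degree]
    congr 1
    ext u
    rw [Finset.mem_filter, mem_neighborFinset, and_iff_right_iff_imp]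
    intro hu
    rcases hb.mem_of_adj hu with h | h
    · exact h.2
    · exact absurd h.1 hv
  have hsum := isBipartiteWith_sum_degrees_eq hb
  rw [Finset.sum_congr rfl h1, Finset.sum_congr rfl h2, Finset.sum_const, Finset.sum_const,
    smul_eq_mul, smul_eq_mul] at hsum
  have hCne : C.Nonempty := by
    obtain ⟨w, hw⟩ := (H.degree_pos_iff_exists_adj _).1 (hd (Classical.arbitrary V))
    rcases hb.mem_of_adj hw with h | h
    · exact ⟨_, h.2⟩
    · exact ⟨_, h.1⟩
  -- Counting edges from both sides gives `n₁ r₁ = n₂ r₂`, and `n₁ ≤ n₂`. The criterion for `D + A`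
  -- of `H` is then `r₂ r₁ ≤ r₁²`.
  have hr : r₂ ≤ r₁ := by
    have : C.card * r₂ ≤ C.card * r₁ := hsum ▸ Nat.mul_le_mul_right r₁ hcard
    exact Nat.le_of_mul_le_mul_left this hCne.card_pos
  obtain ⟨u, hu⟩ := hCne
  have hr₂ : 0 < r₂ := h2 u hu ▸ hd u
  refine lovaszTheta_le_card_of_diagonal_add_adjMatrix hC H hHG
    (H.posSemidef_degMatrix_add_adjMatrix hb) (m := r₂)
    (by exact_mod_cast hr₂) (fun i hi => by simp only [h2 i hi]) (fun i hi => ?_) fun i hi => ?_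
  · rw [hrow i hi]; exact hr₂.trans_le hr
  · rw [hrow i hi, h1 i (hV₁ i hi), sq]
    exact_mod_cast Nat.mul_le_mul_right r₁ hr

theorem lovaszTheta_le_card_of_cliqueCovering [Nonempty V] (hC : G.IsIndepSet (C : Set V))
    {ε : Finset (Finset V)} (hε : G.IsCliqueCovering ε) (hpos : ∀ u, 0 < coveringDegree ε u)
    (hmin : ∀ v ∈ C, ∀ u, coveringDegree ε v ≤ coveringDegree ε u)
    (hone : ∀ Q ∈ ε, (C ∩ Q).card = 1) : G.lovaszTheta ≤ C.card := by
  have hdeg : ∀ u, (Finset.univ.filter fun a : ε => u ∈ (a : Finset V)).card =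
      coveringDegree ε u := fun u => by
    rw [coveringDegree, ← Finset.card_map (Function.Embedding.subtype _)]
    congr 1
    ext Q
    simp [and_comm]
  refine lovaszTheta_le_card_of_cliques hC (fun a : ε => (a : Finset V)) (fun a => hε.1 a a.2)
    (fun u => ?_) (fun v hv u => ?_) fun a => hone a a.2
  · rw [hdeg]; exact hpos u
  · rw [hdeg, hdeg]; exact hmin v hv u

/-- For each vertex `w` of `H`, the edges through `w` form a clique of the intersection graph.
Uniformity puts every edge in exactly `k` of these cliques, and a perfect matching meets each of
them once. -/
theorem lovaszTheta_le_card_of_perfectMatching [Fintype V] [Nonempty V] (hC : G.IsIndepSet (C : Set V))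
    {W : Type*} (H : Hypergraph W) {k : ℕ} (φ : G ≃g H.intersectionGraph) (hk : 0 < k)
    (hu : H.IsUniform k)
    (hP : H.IsPerfectMatching ((fun v => (φ v : Set W)) '' (C : Set V))) :
    G.lovaszTheta ≤ C.card := by
  classical
  obtain ⟨-, hdisj, hcov⟩ := hP
  have hcard : ∀ v, (φ v : Set W).encard = k := fun v => hu _ (φ v).2
  -- The ambient type may be infinite, but finitely many edges of size `k` cover the vertex set.
  have hfin : H.vertexSet.Finite := by
    rw [← hcov]
    refine Set.Finite.sUnion (C.finite_toSet.image _) ?_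
    rintro _ ⟨v, -, rfl⟩
    exact Set.finite_of_encard_eq_coe (hcard v)
  have : Fintype H.vertexSet := hfin.fintype
  let Q : H.vertexSet → Finset V := fun w => Finset.univ.filter fun v => (w : W) ∈ (φ v : Set W)
  have hmem : ∀ v w, v ∈ Q w ↔ (w : W) ∈ (φ v : Set W) := fun v w => by simp [Q]
  have hdeg : ∀ v, (Finset.univ.filter fun w => v ∈ Q w).card = k := fun v => by
    have h1 : (((Finset.univ.filter fun w => v ∈ Q w).map (Function.Embedding.subtype _) :
        Finset W) : Set W) = (φ v : Set W) := by
      ext w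
      simp only [Finset.coe_map, Set.mem_image, Finset.mem_coe, Finset.mem_filter,
        Finset.mem_univ, true_and, hmem]
      constructor
      · rintro ⟨w, hw, rfl⟩
        exact hw
      · exact fun hw => ⟨⟨w, H.subset_vertexSet_of_mem_edgeSet (φ v).2 hw⟩, hw, rfl⟩
    have h2 := hcard v
    rw [← h1, Set.encard_coe_eq_coe_finsetCard, Finset.card_map] at h2
    exact_mod_cast h2
  refine lovaszTheta_le_card_of_cliques hC Q (fun w u hu v hv huv => ?_)
    (fun u => by rwa [hdeg]) (fun v _ u => by rw [hdeg, hdeg]) fun w => ?_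
  · rw [← φ.map_adj_iff]
    exact ⟨φ.injective.ne huv, w, (hmem u w).1 hu, (hmem v w).1 hv⟩
  · have hw : (w : W) ∈ ⋃₀ ((fun v => (φ v : Set W)) '' (C : Set V)) := by
      rw [hcov]
      exact w.2
    obtain ⟨_, ⟨v, hv, rfl⟩, hwv⟩ := hw
    rw [Finset.card_eq_one]
    refine ⟨v, Finset.ext fun u => ?_⟩
    rw [Finset.mem_inter, Finset.mem_singleton, hmem]
    constructor
    · rintro ⟨huC, huw⟩
      have h1 : (φ u : Set W) = φ v :=
        hdisj.elim ⟨u, huC, rfl⟩ ⟨v, hv, rfl⟩ (Set.not_disjoint_iff.2 ⟨w, huw, hwv⟩)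
      exact φ.injective (Subtype.ext h1)
    · rintro rfl
      exact ⟨hv, hwv⟩

end SimpleGraph

theorem theorem7p1 {V : Type*} [Fintype V] [DecidableEq V] [Nonempty V]
    (G : SimpleGraph V) [DecidableRel G.Adj] (C : Finset V) (hC : G.IsIndepSet (C : Set V))
    (h :
      -- more than `-τ` neighbours in `C`, `τ` the least adjacency eigenvalue
      (∃ (τ : ℝ) (l : ℕ), IsLeast (G.adjMatrix ℝ).eigenvalueSet τ ∧ -τ < (l : ℝ) ∧
        ∀ v ∉ C, (C.filter fun u => G.Adj v u).card = l) ∨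
      -- `G` regular, exactly `-τ` neighbours in `C`
      (∃ (τ : ℝ) (r : ℕ), IsLeast (G.adjMatrix ℝ).eigenvalueSet τ ∧ τ < 0 ∧
        G.IsRegularOfDegree r ∧
        ∀ v ∉ C, ((C.filter fun u => G.Adj v u).card : ℝ) = -τ) ∨
      -- largest Laplacian eigenvalue
      (∃ μ : ℝ, IsGreatest (G.lapMatrix ℝ).eigenvalueSet μ ∧ 0 < μ ∧
        (∀ u ∈ C, G.degree u = G.minDegree) ∧
        ∀ v ∉ C, ((C.filter fun u => G.Adj v u).card : ℝ) = μ - (G.minDegree : ℝ)) ∨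
      -- largest normalized Laplacian eigenvalue
      (∃ μ : ℝ, IsGreatest G.normLapMatrix.eigenvalueSet μ ∧ 0 < G.minDegree ∧
        (∀ u ∈ C, G.degree u = G.minDegree) ∧
        ∀ v ∉ C, ((C.filter fun u => G.Adj v u).card : ℝ) = (μ - 1) * (G.degree v : ℝ)) ∨
      -- join-type structure
      ((∀ v ∉ C, ∀ u ∈ C, G.Adj v u) ∧
        Fintype.card V ≤ 2 * C.card + (G.induce {v | v ∉ C}).minDegree) ∨
      -- semiregular bipartite spanning subgraph
      (∃ (H : SimpleGraph V) (_ : DecidableRel H.Adj) (V₁ : Finset V) (r₁ r₂ : ℕ),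
        H ≤ G ∧ 0 < H.minDegree ∧ H.IsSemiregularBipartite V₁ C r₁ r₂ ∧ V₁.card ≤ C.card) ∨
      -- clique covering
      (∃ ε : Finset (Finset V), G.IsCliqueCovering ε ∧ (∀ u, 0 < coveringDegree ε u) ∧
        (∀ v ∈ C, ∀ u, coveringDegree ε v ≤ coveringDegree ε u) ∧
        ∀ Q ∈ ε, (C ∩ Q).card = 1) ∨
      -- perfect matching of a uniform hypergraph
      (∃ (W : Type*) (H : Hypergraph W) (k : ℕ) (φ : G ≃g H.intersectionGraph),
        0 < k ∧ H.IsUniform k ∧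
        H.IsPerfectMatching ((fun v => (φ v : Set W)) '' (C : Set V)))) :
    G.indepNum = C.card ∧ G.shannonCapacity = (C.card : ℝ) ∧
      G.lovaszTheta = (C.card : ENNReal) := by
  refine SimpleGraph.eq_card_of_lovaszTheta_le_card hC ?_
  rcases h with ⟨τ, l, hτ, hl, h⟩ | ⟨τ, r, hτ, hneg, -, h⟩ | ⟨μ, hμ, hpos, hdeg, h⟩ |
    ⟨μ, hμ, hpos, hdeg, h⟩ | ⟨hadj, h⟩ | ⟨H, _, V₁, r₁, r₂, hHG, hpos, hH, h⟩ |
    ⟨ε, hε, hpos, hmin, h⟩ | ⟨W, H, k, φ, hk, hu, hP⟩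
  · exact SimpleGraph.lovaszTheta_le_card_of_gt_adjacency hC hτ fun v hv => by rwa [h v hv]
  · exact SimpleGraph.lovaszTheta_le_card_of_adjacency hC hτ hneg fun v hv => (h v hv).ge
  · exact SimpleGraph.lovaszTheta_le_card_of_laplacian hC hμ hpos hdeg h
  · exact SimpleGraph.lovaszTheta_le_card_of_normalizedLaplacian hC hμ hpos hdeg h
  · refine SimpleGraph.lovaszTheta_le_card_of_join hC hadj ?_
    convert h
  · exact SimpleGraph.lovaszTheta_le_card_of_semiregularBipartite hC H hHG hpos hH h
  · exact SimpleGraph.lovaszTheta_le_card_of_cliqueCovering hC hε hpos hmin h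
  · exact SimpleGraph.lovaszTheta_le_card_of_perfectMatching hC H φ hk hu hP
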